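/- Let $1<p<\infty$, $0\le t<1$ and $\mathbb N_0=\{0,1,2,\dots\}$. Let $bv_p$ be the Banach space of all complex sequences $x=(x_n)_{n\in\mathbb N_0}$ with $$\|x\|_{bv_p}:=\Big(|x_0|^p+\sum_{k=0}^\infty|x_{k+1}-x_k|^p\Big)^{1/p}<\infty .$$ For a complex sequence $x$ let $$C_tx:=\Big(\frac{t^nx_0+t^{n-1}x_1+\dots+x_n}{n+1}\Big)_{n\in\mathbb N_0}$$ (with $0^0=1$), and put $\Lambda:=\{\frac1{n+1}: n\in\mathbb N_0\}$ and $\Lambda_0:=\Lambda\cup\{0\}$. Then $C_t$ maps $bv_p$ into $bv_p$, and the resulting operator $C_t\colon bv_p\to bv_p$ is continuous and compact. Its point spectrum (the set of its eigenvalues) and its spectrum are $$\sigma_{pt}(C_t;bv_p)=\Lambda\quad\text{and}\quad \sigma(C_t;bv_p)=\Lambda_0 .$$ Moreover, $C_t$ is power bounded on $bv_p$, that is, $\sup_{n\ge1}\|C_t^n\|<\infty$; it is uniformly mean ergodic, that is, the averages $\frac1n\sum_{m=1}^nC_t^m$ converge in operator norm as $n\to\infty$ to a continuous linear operator on $bv_p$;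 and it is not supercyclic, that is, there is no $x\in bv_p$ for which $\{\lambda C_t^nx:\lambda\in\mathbb C,\ n\in\mathbb N_0\}$ is dense in $bv_p$. -/

import Mathlib

open Filter Topology

noncomputable section

/-- The space `bv_p` of complex sequences of `p`-bounded variation, `1 < p < ∞`, as a linear
subspace of the space `ω` of all complex sequences: those `x` for which
`∑_{k ≥ 0} |x_{k+1} - x_k|^p < ∞`. -/
def bvSubmodule (p : ℝ) [hp : Fact (1 < p)] : Submodule ℂ (ℕ → ℂ) where
  carrier := {x | Summable fun k => ‖x (k + 1) - x k‖ ^ p}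
  zero_mem' := by
    have h0 : p ≠ 0 := (zero_lt_one.trans hp.out).ne'
    simp [Real.zero_rpow h0]
  add_mem' := by
    intro x y hx hy
    have h := Real.summable_Lp_add_of_nonneg hp.out.le (fun k => norm_nonneg (x (k + 1) - x k))
      (fun k => norm_nonneg (y (k + 1) - y k)) hx hy
    refine Summable.of_nonneg_of_le (fun k => by positivity) (fun k => ?_) h
    have hp0 : 0 ≤ p := zero_le_one.trans hp.out.le
    refine Real.rpow_le_rpow (norm_nonneg _) ?_ hp0
    have : (x + y) (k + 1) - (x + y) k = (x (k + 1) - x k) + (y (k + 1) - y k) := by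
      simp only [Pi.add_apply]; ring
    rw [this]
    exact norm_add_le _ _
  smul_mem' := by
    intro c x hx
    have h : Summable fun k => ‖c‖ ^ p * ‖x (k + 1) - x k‖ ^ p := Summable.mul_left _ hx
    refine h.congr (fun k => ?_)
    rw [← Real.mul_rpow (norm_nonneg _) (norm_nonneg _), ← norm_mul, mul_sub]
    rfl

/-- The type of elements of `bv_p`. It is a separate type, so that its topology is that of the norm
below and not the topology of coordinatewise convergence inherited from `ω`. -/
def BV (p : ℝ) [Fact (1 < p)] : Type := bvSubmodule p

namespace BV

variable {p : ℝ} [hp : Fact (1 < p)]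

instance : AddCommGroup (BV p) := inferInstanceAs (AddCommGroup (bvSubmodule p))

instance : Module ℂ (BV p) := inferInstanceAs (Module ℂ (bvSubmodule p))

/-- The inclusion of `bv_p` into the space of all sequences. -/
def toSeq : BV p →ₗ[ℂ] (ℕ → ℂ) := (bvSubmodule p).subtype

instance : CoeFun (BV p) (fun _ => ℕ → ℂ) := ⟨fun x => toSeq x⟩

/-- `‖x‖ = (|x_0|^p + ∑_{k ≥ 0} |x_{k+1} - x_k|^p)^{1/p}`. -/
instance : Norm (BV p) :=
  ⟨fun x => (‖x 0‖ ^ p + ∑' k, ‖x (k + 1) - x k‖ ^ p) ^ (1 / p)⟩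

theorem norm_def (x : BV p) :
    ‖x‖ = (‖x 0‖ ^ p + ∑' k, ‖x (k + 1) - x k‖ ^ p) ^ (1 / p) := rfl

theorem summable_diff (x : BV p) : Summable fun k => ‖x (k + 1) - x k‖ ^ p := x.2

/-- The sequence `(x_0, x_1 - x_0, x_2 - x_1, …)`. -/
def diff (x : BV p) : ℕ → ℂ
  | 0 => x 0
  | k + 1 => x (k + 1) - x k

theorem summable_norm_diff (x : BV p) : Summable fun k => ‖diff x k‖ ^ p :=
  (summable_nat_add_iff 1).1 (summable_diff x)

theorem norm_eq_diff (x : BV p) : ‖x‖ = (∑' k, ‖diff x k‖ ^ p) ^ (1 / p) := by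
  rw [(summable_norm_diff x).tsum_eq_zero_add]
  rfl

theorem diff_add (x y : BV p) (k : ℕ) : diff (x + y) k = diff x k + diff y k := by
  cases k with
  | zero => simp [diff]
  | succ k => simp only [diff, map_add, Pi.add_apply]; ring

theorem diff_smul (c : ℂ) (x : BV p) (k : ℕ) : diff (c • x) k = c * diff x k := by
  cases k with
  | zero => simp [diff]
  | succ k => simp only [diff, map_smul, Pi.smul_apply, smul_eq_mul]; ring

theorem eq_zero_of_diff {x : BV p} (h : ∀ k, diff x k = 0) : x = 0 := by
  refine Subtype.ext (funext fun n => ?_)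
  change x n = 0
  induction n with
  | zero => exact h 0
  | succ n ih => simpa [diff, ih] using h (n + 1)

theorem normCore : NormedSpace.Core ℂ (BV p) where
  norm_nonneg x := by
    rw [norm_eq_diff]
    exact Real.rpow_nonneg (tsum_nonneg fun k => by positivity) _
  norm_smul c x := by
    have h0 : p ≠ 0 := (zero_lt_one.trans hp.out).ne'
    have h : ∀ k, ‖diff (c • x) k‖ ^ p = ‖c‖ ^ p * ‖diff x k‖ ^ p := fun k => by
      rw [diff_smul, norm_mul, Real.mul_rpow (norm_nonneg _) (norm_nonneg _)]
    rw [norm_eq_diff, norm_eq_diff, tsum_congr h, tsum_mul_left,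
      Real.mul_rpow (by positivity) (tsum_nonneg fun k => by positivity), one_div,
      Real.rpow_rpow_inv (norm_nonneg _) h0]
  norm_triangle x y := by
    have hp0 : 0 < p := zero_lt_one.trans hp.out
    have hx := summable_norm_diff x
    have hy := summable_norm_diff y
    have hs := Real.summable_Lp_add_of_nonneg hp.out.le (fun k => norm_nonneg (diff x k))
      (fun k => norm_nonneg (diff y k)) hx hy
    rw [norm_eq_diff, norm_eq_diff, norm_eq_diff]
    refine le_trans ?_ (Real.Lp_add_le_tsum_of_nonneg' hp.out.le (fun k => norm_nonneg (diff x k))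
      (fun k => norm_nonneg (diff y k)) hx hy)
    refine Real.rpow_le_rpow (tsum_nonneg fun k => by positivity) ?_ (by positivity)
    refine (summable_norm_diff (x + y)).tsum_le_tsum (fun k => ?_) hs
    rw [diff_add]
    exact Real.rpow_le_rpow (norm_nonneg _) (norm_add_le _ _) hp0.le
  norm_eq_zero_iff x := by
    have hp0 : 0 < p := zero_lt_one.trans hp.out
    constructor
    · intro h
      rw [norm_eq_diff, Real.rpow_eq_zero (tsum_nonneg fun k => by positivity)
        (one_div_pos.2 hp0).ne'] at h
      refine eq_zero_of_diff fun k => ?_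
      have hz : ‖diff x k‖ ^ p = 0 := le_antisymm
        (h ▸ (summable_norm_diff x).le_tsum k (fun j _ => by positivity)) (by positivity)
      rwa [Real.rpow_eq_zero (norm_nonneg _) hp0.ne', norm_eq_zero] at hz
    · rintro rfl
      simp [norm_def, Real.zero_rpow hp0.ne', hp0.ne']

instance : NormedAddCommGroup (BV p) := NormedAddCommGroup.ofCore normCore

instance : NormedSpace ℂ (BV p) := NormedSpace.ofCore normCore

end BV

/-- The generalized Cesàro operator `C_t` on the space of all complex sequences,
`(C_t x)_n = (t^n x_0 + t^(n-1) x_1 + ⋯ + x_n) / (n + 1)`. -/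
def genCesaro (t : ℝ) (x : ℕ → ℂ) (n : ℕ) : ℂ :=
  (∑ i ∈ Finset.range (n + 1), (t : ℂ) ^ (n - i) * x i) / ((n : ℂ) + 1)

section Operators

variable {X : Type*} [NormedAddCommGroup X] [NormedSpace ℂ X]

/-- The set of eigenvalues of `T`. -/
def pointSpectrum (T : X →L[ℂ] X) : Set ℂ :=
  {z | Module.End.HasEigenvalue (T : X →ₗ[ℂ] X) z}

/-- `sup_n ‖T^n‖ < ∞`. -/
def IsPowerBounded (T : X →L[ℂ] X) : Prop :=
  ∃ M : ℝ, ∀ n : ℕ, ‖T ^ n‖ ≤ M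

/-- The Cesàro means `(1/n) ∑_{m=1}^n T^m` converge in operator norm. -/
def IsUniformlyMeanErgodic (T : X →L[ℂ] X) : Prop :=
  ∃ P : X →L[ℂ] X,
    Tendsto (fun n : ℕ => (n : ℂ)⁻¹ • ∑ m ∈ Finset.Icc 1 n, T ^ m) atTop (𝓝 P)

/-- Some projective orbit `{c T^n x : c ∈ ℂ, n ≥ 0}` is dense. -/
def IsSupercyclic (T : X →L[ℂ] X) : Prop :=
  ∃ x : X, Dense {y : X | ∃ (c : ℂ) (n : ℕ), y = c • (T ^ n) x}

end Operators

end

/-! Taking differences identifies `bv_p` with `ℓ^p`. The numerators of `C_t x` satisfy `s_{n+1} = t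
s_n + x_{n+1}`, and since `t < 1` their differences stay bounded by a multiple of `‖x‖`. Dividing by
`n + 1` makes the differences of `C_t x` of size `O(‖x‖ / n)`, which is `p`-summable because `p >
1`. This uniform domination gives both boundedness and compactness.

`C_t` is lower triangular with diagonal `1 / (n + 1)`, so the first nonzero coordinate of an
eigenvector determines its eigenvalue; binomial sequences realize every one of them. Compactness
then yields the spectrum.

The rank-one projection `P x = x_0 (t^n)_n` satisfies `C_t P = P C_t = P`, and `C_t - P` has
spectral radius at most `1/2`. Hence `C_t^n = P + (C_t - P)^n → P` in norm, which gives power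
boundedness and mean ergodicity. Supercyclicity fails because `x_0` and `x_1 - t x_0` are
eigenfunctionals of the adjoint for `1` and `1/2`. -/

noncomputable section

/-! ### Differences, completeness and a compactness criterion in `bv_p` -/

namespace BV

variable {p : ℝ} [hp : Fact (1 < p)]

theorem exponent_pos (p : ℝ) [hp : Fact (1 < p)] : 0 < p := zero_lt_one.trans hp.out

@[ext]
theorem ext {x y : BV p} (h : ∀ n, x n = y n) : x = y :=
  Subtype.ext (funext h)

/-- A sequence of `p`-bounded variation as an element of `bv_p`. -/
def mk (x : ℕ → ℂ) (h : Summable fun k => ‖x (k + 1) - x k‖ ^ p) : BV p := ⟨x, h⟩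

@[simp]
theorem mk_apply (x : ℕ → ℂ) (h : Summable fun k => ‖x (k + 1) - x k‖ ^ p) (n : ℕ) :
    mk x h n = x n := rfl

theorem ext_diff {x y : BV p} (h : ∀ k, diff x k = diff y k) : x = y := by
  rw [← sub_eq_zero]
  refine eq_zero_of_diff fun k => ?_
  have := diff_add (x - y) y k
  rw [sub_add_cancel, h k] at this
  simpa using this

/-- The sequence of partial sums of a `p`-summable sequence. -/
def ofDiff (d : ℕ → ℂ) (h : Summable fun k => ‖d k‖ ^ p) : BV p :=
  mk (fun n => ∑ i ∈ Finset.range (n + 1), d i) <| by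
    refine ((summable_nat_add_iff 1).2 h).congr fun k => ?_
    rw [Finset.sum_range_succ _ (k + 1), add_sub_cancel_left]

@[simp]
theorem diff_ofDiff (d : ℕ → ℂ) (h : Summable fun k => ‖d k‖ ^ p) (k : ℕ) :
    diff (ofDiff d h) k = d k := by
  cases k with
  | zero => simp [diff, ofDiff]
  | succ k =>
    simp only [diff, ofDiff, mk_apply]
    rw [Finset.sum_range_succ _ (k + 1), add_sub_cancel_left]

theorem norm_rpow (x : BV p) : ‖x‖ ^ p = ∑' k, ‖diff x k‖ ^ p := by
  rw [norm_eq_diff, one_div, Real.rpow_inv_rpow (tsum_nonneg fun k => by positivity)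
    (exponent_pos p).ne']

theorem norm_diff_le (x : BV p) (k : ℕ) : ‖diff x k‖ ≤ ‖x‖ := by
  rw [← Real.rpow_le_rpow_iff (norm_nonneg _) (norm_nonneg _) (exponent_pos p), norm_rpow]
  exact (summable_norm_diff x).le_tsum k fun j _ => by positivity

theorem norm_le_of_diff {x : BV p} {a : ℕ → ℝ} (ha : Summable a)
    (h : ∀ k, ‖diff x k‖ ^ p ≤ a k) : ‖x‖ ≤ (∑' k, a k) ^ (1 / p) := by
  rw [norm_eq_diff]
  exact Real.rpow_le_rpow (tsum_nonneg fun k => by positivity)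
    ((summable_norm_diff x).tsum_le_tsum h ha) (one_div_pos.2 (exponent_pos p)).le

/-- The identification of `bv_p` with `ℓ^p` by means of the differences. -/
def equivLp (p : ℝ) [hp : Fact (1 < p)] [Fact (1 ≤ ENNReal.ofReal p)] :
    BV p ≃ₗᵢ[ℂ] lp (fun _ : ℕ => ℂ) (ENNReal.ofReal p) :=
  have htr : (ENNReal.ofReal p).toReal = p := ENNReal.toReal_ofReal (exponent_pos p).le
  { toFun := fun x => ⟨diff x, memℓp_gen <| by rw [htr]; exact summable_norm_diff x⟩
    map_add' := fun x y => Subtype.ext <| funext fun k => diff_add x y k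
    map_smul' := fun c x => Subtype.ext <| funext fun k => diff_smul c x k
    invFun := fun f => ofDiff f <| by
      simpa only [htr] using (lp.memℓp f).summable (by rw [htr]; exact exponent_pos p)
    left_inv := fun x => ext_diff fun k => by rw [diff_ofDiff]
    right_inv := fun f => Subtype.ext <| funext fun k => diff_ofDiff _ _ k
    norm_map' := fun x => by
      rw [lp.norm_eq_tsum_rpow (by rw [htr]; exact exponent_pos p)]
      change (∑' k, ‖diff x k‖ ^ (ENNReal.ofReal p).toReal) ^ (1 / (ENNReal.ofReal p).toReal) = ‖x‖
      rw [htr, norm_eq_diff] }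

instance : CompleteSpace (BV p) := by
  have : Fact (1 ≤ ENNReal.ofReal p) := ⟨by simpa using hp.out.le⟩
  exact (equivLp p).toIsometryEquiv.completeSpace

/-- The difference functionals on `bv_p`. -/
def diffL (p : ℝ) [hp : Fact (1 < p)] (k : ℕ) : BV p →L[ℂ] ℂ :=
  LinearMap.mkContinuous
    { toFun := fun x => diff x k
      map_add' := fun x y => diff_add x y k
      map_smul' := fun c x => diff_smul c x k } 1 fun x => by
    rw [one_mul]; exact norm_diff_le x k

@[simp]
theorem diffL_apply (k : ℕ) (x : BV p) : diffL p k x = diff x k := rfl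

/-- The element of `bv_p` whose differences are the `k`-th unit vector. -/
def unitDiff (p : ℝ) [hp : Fact (1 < p)] (k : ℕ) : BV p :=
  ofDiff (Pi.single k 1) <| by
    refine summable_of_ne_finset_zero (s := {k}) fun j hj => ?_
    rw [Pi.single_eq_of_ne (by simpa using hj), norm_zero, Real.zero_rpow (exponent_pos p).ne']

/-- The finite-rank operator that keeps the first `N` differences. -/
def truncate (p : ℝ) [hp : Fact (1 < p)] (N : ℕ) : BV p →L[ℂ] BV p :=
  ∑ k ∈ Finset.range N, (diffL p k).smulRight (unitDiff p k)

theorem diff_truncate (N : ℕ) (x : BV p) (j : ℕ) :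
    diff (truncate p N x) j = if j < N then diff x j else 0 := by
  rw [← diffL_apply, truncate, sum_apply, map_sum]
  simp [unitDiff, Pi.single_apply]

theorem isCompactOperator_truncate (N : ℕ) : IsCompactOperator (truncate p N) := by
  have h : truncate p N ∈ compactOperator (RingHom.id ℂ) (BV p) (BV p) := by
    refine Submodule.sum_mem _ fun k _ => ?_
    exact (isCompactOperator_id (E := ℂ)).comp_clm (diffL p k) |>.clm_comp
      ((1 : ℂ →L[ℂ] ℂ).smulRight (unitDiff p k))
  exact h

/-- An operator whose values have differences dominated by a `p`-summable sequence is compact. -/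
theorem isCompactOperator_of_diff_le {T : BV p →L[ℂ] BV p} {a : ℕ → ℝ} (ha0 : ∀ k, 0 ≤ a k)
    (ha : Summable fun k => a k ^ p) (h : ∀ x k, ‖diff (T x) k‖ ≤ a k * ‖x‖) :
    IsCompactOperator T := by
  have hp0 := exponent_pos p
  -- Truncations of `T` have finite rank and differ from `T` by at most the `ℓ^p` tail of `a`.
  refine isCompactOperator_of_tendsto (l := atTop) (F := fun N => (truncate p N).comp T) ?_
    (Eventually.of_forall fun N => (isCompactOperator_truncate N).comp_clm T)
  rw [tendsto_iff_norm_sub_tendsto_zero]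
  have htail : Tendsto (fun N => (∑' k, a (k + N) ^ p) ^ (1 / p)) atTop (𝓝 0) := by
    have := (tendsto_sum_nat_add fun k => a k ^ p).rpow_const
      (p := 1 / p) (Or.inr (one_div_pos.2 hp0).le)
    rwa [Real.zero_rpow (one_div_pos.2 hp0).ne'] at this
  refine squeeze_zero (fun _ => norm_nonneg _) (fun N => ?_) htail
  have hsN := (summable_nat_add_iff N).2 ha
  have ht0 : 0 ≤ ∑' k, a (k + N) ^ p := tsum_nonneg fun k => Real.rpow_nonneg (ha0 _) _
  refine ContinuousLinearMap.opNorm_le_bound _ (Real.rpow_nonneg ht0 _) fun x => ?_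
  have hd : ∀ j, diff (((truncate p N).comp T - T) x) j = if j < N then 0 else -diff (T x) j := by
    intro j
    have := diff_add (((truncate p N).comp T - T) x) (T x) j
    rw [sub_apply, sub_add_cancel, ContinuousLinearMap.comp_apply,
      diff_truncate] at this
    rw [sub_apply, ContinuousLinearMap.comp_apply, eq_sub_of_add_eq this.symm]
    split_ifs <;> simp
  rw [← Real.rpow_le_rpow_iff (norm_nonneg _) (by positivity) hp0, norm_rpow,
    Real.mul_rpow (by positivity) (norm_nonneg _), one_div, Real.rpow_inv_rpow ht0 hp0.ne',
    ← (summable_norm_diff (((truncate p N).comp T - T) x)).sum_add_tsum_nat_add N,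
    Finset.sum_eq_zero, zero_add, ← tsum_mul_right]
  · refine Summable.tsum_le_tsum (fun k => ?_)
      ((summable_nat_add_iff N).2 (summable_norm_diff _)) (hsN.mul_right _)
    rw [hd, if_neg (by omega), norm_neg, ← Real.mul_rpow (ha0 _) (norm_nonneg _)]
    exact Real.rpow_le_rpow (norm_nonneg _) (h x _) hp0.le
  · intro j hj
    rw [hd, if_pos (Finset.mem_range.1 hj), norm_zero, Real.zero_rpow hp0.ne']

/-- An absolutely summable sequence is of `p`-bounded variation. -/
theorem summable_diff_of_summable_norm {x : ℕ → ℂ} (hx : Summable fun n => ‖x n‖) :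
    Summable fun k => ‖x (k + 1) - x k‖ ^ p := by
  have hs : Summable fun k => ‖x (k + 1) - x k‖ :=
    Summable.of_nonneg_of_le (fun _ => norm_nonneg _) (fun k => norm_sub_le _ _)
      (((summable_nat_add_iff 1).2 hx).add hx)
  -- The differences tend to `0`, and `r ^ p ≤ r` once `r ≤ 1`.
  refine hs.of_norm_bounded_eventually_nat ?_
  filter_upwards [hs.tendsto_atTop_zero.eventually_le_const one_pos] with k hk
  rw [Real.norm_of_nonneg (by positivity)]
  exact Real.rpow_le_self_of_le_one (norm_nonneg _) hk hp.out.le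

end BV

/-! ### Powers, ergodicity and supercyclicity of general operators -/

/-- By Gelfand's formula, `‖a ^ n‖ ≤ c ^ n` eventually, for any `c` strictly between the spectral
radius and `1`. -/
theorem spectrum.tendsto_pow_zero_of_spectralRadius_lt_one {A : Type*} [NormedRing A]
    [NormedAlgebra ℂ A] [CompleteSpace A] {a : A} (h : spectralRadius ℂ a < 1) :
    Tendsto (fun n : ℕ => a ^ n) atTop (𝓝 0) := by
  obtain ⟨c, hc, hc1⟩ := ENNReal.lt_iff_exists_nnreal_btwn.1 h
  have hc1' : c < 1 := by exact_mod_cast hc1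
  rw [tendsto_zero_iff_norm_tendsto_zero]
  refine squeeze_zero' (Eventually.of_forall fun _ => norm_nonneg _) ?_
    (tendsto_pow_atTop_nhds_zero_of_lt_one c.coe_nonneg (by exact_mod_cast hc1'))
  filter_upwards [(pow_nnnorm_pow_one_div_tendsto_nhds_spectralRadius a).eventually_lt_const hc,
    eventually_gt_atTop 0] with n hn hn0
  have hn0' : (0 : ℝ) < n := by exact_mod_cast hn0
  have := ENNReal.rpow_le_rpow hn.le hn0'.le
  rw [← ENNReal.rpow_mul, one_div_mul_cancel hn0'.ne', ENNReal.rpow_one,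
    ENNReal.rpow_natCast] at this
  exact_mod_cast this

/-- All mixed products collapse to `e`. The exponent starts at `1` because `(a - e) ^ 0 = 1`. -/
theorem sub_pow_succ_of_absorbing {R : Type*} [Ring R] {a e : R} (he : e * e = e)
    (hae : a * e = e) (hea : e * a = e) (n : ℕ) : (a - e) ^ (n + 1) = a ^ (n + 1) - e := by
  induction n with
  | zero => simp
  | succ n ih =>
    have h : ∀ m : ℕ, a ^ m * e = e := fun m => by
      induction m with
      | zero => simp
      | succ m ih => rw [pow_succ, mul_assoc, hae, ih]
    rw [pow_succ, ih, sub_mul, mul_sub, mul_sub, he, hea, h, ← pow_succ, sub_self, sub_zero]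

section Operators

variable {X : Type*} [NormedAddCommGroup X] [NormedSpace ℂ X] {T P : X →L[ℂ] X}

theorem IsPowerBounded.of_tendsto (h : Tendsto (fun n : ℕ => T ^ n) atTop (𝓝 P)) :
    IsPowerBounded T := by
  obtain ⟨M, hM⟩ := h.norm.bddAbove_range
  exact ⟨M, fun n => hM ⟨n, rfl⟩⟩

theorem IsUniformlyMeanErgodic.of_tendsto (h : Tendsto (fun n : ℕ => T ^ n) atTop (𝓝 P)) :
    IsUniformlyMeanErgodic T := by
  refine ⟨P, ?_⟩
  refine (((tendsto_add_atTop_iff_nat 1).2 h).cesaro_smul).congr fun n => ?_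
  rw [← Complex.coe_smul, Complex.ofReal_inv, Complex.ofReal_natCast,
    Finset.range_eq_Ico, Finset.sum_Ico_add' (fun m => T ^ m) 0 n 1]
  rfl

/-- An operator whose adjoint has two eigenvectors `f`, `g` with eigenvalues `1` and `c`,
`‖c‖ ≤ 1`, is not supercyclic if `f` and `g` can be separated. -/
theorem not_isSupercyclic_of_dual_eigenvectors {f g : X →L[ℂ] ℂ} {c : ℂ} (hc : ‖c‖ ≤ 1)
    (hf : ∀ x, f (T x) = f x) (hg : ∀ x, g (T x) = c * g x) {u v : X} (hu : f u ≠ 0)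
    (hv : f v = 0) (hgv : g v ≠ 0) : ¬ IsSupercyclic T := by
  rintro ⟨x, hx⟩
  have hfn : ∀ n : ℕ, f ((T ^ n) x) = f x := fun n => by
    induction n with
    | zero => rfl
    | succ n ih =>
      rw [pow_succ', ContinuousLinearMap.mul_def, ContinuousLinearMap.comp_apply, hf, ih]
  have hgn : ∀ n : ℕ, ‖g ((T ^ n) x)‖ ≤ ‖g x‖ := fun n => by
    induction n with
    | zero => rfl
    | succ n ih =>
      rw [pow_succ', ContinuousLinearMap.mul_def, ContinuousLinearMap.comp_apply, hg, norm_mul]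
      exact (mul_le_of_le_one_left (norm_nonneg _) hc).trans ih
  -- Along the orbit `f` is constant and `‖g‖` never exceeds `‖g x‖`. The resulting inequality is
  -- homogeneous and closed, so it passes from the dense projective orbit to all of `X`.
  have hle : ∀ z, ‖g z‖ * ‖f x‖ ≤ ‖f z‖ * ‖g x‖ := by
    have hcl : IsClosed {z : X | ‖g z‖ * ‖f x‖ ≤ ‖f z‖ * ‖g x‖} :=
      isClosed_le (by fun_prop) (by fun_prop)
    refine fun z => hcl.closure_subset_iff.2 ?_ (hx z)
    rintro _ ⟨a, n, rfl⟩
    simp only [Set.mem_ofPred_eq, map_smul, norm_smul, hfn]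
    calc ‖a‖ * ‖g ((T ^ n) x)‖ * ‖f x‖ ≤ ‖a‖ * ‖g x‖ * ‖f x‖ := by gcongr; exact hgn n
      _ = ‖a‖ * ‖f x‖ * ‖g x‖ := by ring
  -- Evaluating at `v` forces `f x = 0`; then `f` vanishes on the orbit, hence everywhere,
  -- contradicting `hu`.
  have hfx : f x = 0 := by
    have h := hle v
    rw [hv, norm_zero, zero_mul] at h
    have h0 := le_antisymm h (by positivity)
    exact norm_eq_zero.1 ((mul_eq_zero.1 h0).resolve_left (norm_ne_zero_iff.2 hgv))
  have hcl : IsClosed {z : X | f z = 0} := isClosed_eq f.continuous continuous_const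
  refine hu (hcl.closure_subset_iff.2 ?_ (hx u))
  rintro _ ⟨a, n, rfl⟩
  simp only [Set.mem_ofPred_eq, map_smul, hfn, hfx, smul_zero]

end Operators

/-- The numerators `t^n x_0 + ⋯ + x_n` of `genCesaro`. -/
def cesaroSum (t : ℝ) (x : ℕ → ℂ) (n : ℕ) : ℂ :=
  ∑ i ∈ Finset.range (n + 1), (t : ℂ) ^ (n - i) * x i

/-! ### Coordinate estimates and binomial eigenvectors -/

section Sequences

variable {t : ℝ} {x : ℕ → ℂ}

theorem cesaroSum_zero : cesaroSum t x 0 = x 0 := by simp [cesaroSum]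

theorem cesaroSum_succ (n : ℕ) : cesaroSum t x (n + 1) = t * cesaroSum t x n + x (n + 1) := by
  rw [cesaroSum, Finset.sum_range_succ, Nat.sub_self, pow_zero, one_mul, cesaroSum,
    Finset.mul_sum]
  congr 1
  refine Finset.sum_congr rfl fun i hi => ?_
  rw [Nat.succ_sub (Nat.lt_succ_iff.1 (Finset.mem_range.1 hi)), pow_succ']
  ring

theorem genCesaro_eq (n : ℕ) : genCesaro t x n = cesaroSum t x n / ((n : ℂ) + 1) := rfl

theorem genCesaro_zero : genCesaro t x 0 = x 0 := by
  simp [genCesaro_eq, cesaroSum_zero]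

theorem genCesaro_of_forall_lt {m : ℕ} (h : ∀ i < m, x i = 0) :
    genCesaro t x m = x m / ((m : ℂ) + 1) := by
  rw [genCesaro, Finset.sum_range_succ, Finset.sum_eq_zero, zero_add, Nat.sub_self, pow_zero,
    one_mul]
  intro i hi
  rw [h i (Finset.mem_range.1 hi), mul_zero]

theorem genCesaro_add (x y : ℕ → ℂ) : genCesaro t (x + y) = genCesaro t x + genCesaro t y := by
  funext n
  simp only [genCesaro, Pi.add_apply, mul_add, Finset.sum_add_distrib, add_div]

theorem genCesaro_smul (c : ℂ) (x : ℕ → ℂ) : genCesaro t (c • x) = c • genCesaro t x := by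
  funext n
  simp only [genCesaro, Pi.smul_apply, smul_eq_mul, mul_left_comm _ c, ← Finset.mul_sum,
    mul_div_assoc]

/-- The differences of the numerators satisfy the same recursion as the numerators, and `M / (1 -
t)` is the fixed point of `s ↦ t * s + M`. -/
theorem norm_cesaroSum_sub_le (ht0 : 0 ≤ t) (ht1 : t < 1) {M : ℝ} (h0 : ‖x 0‖ ≤ M)
    (h : ∀ k, ‖x (k + 1) - x k‖ ≤ M) (n : ℕ) :
    ‖cesaroSum t x (n + 1) - cesaroSum t x n‖ ≤ M / (1 - t) := by
  have hpos : 0 < 1 - t := sub_pos.2 ht1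
  have htn : ‖(t : ℂ)‖ = t := by rw [Complex.norm_real, Real.norm_of_nonneg ht0]
  have key : ∀ a b : ℂ, ‖a‖ ≤ M / (1 - t) → ‖b‖ ≤ M → ‖t * a + b‖ ≤ M / (1 - t) :=
    fun a b ha hb => calc
      ‖t * a + b‖ ≤ t * ‖a‖ + ‖b‖ := by
        refine (norm_add_le _ _).trans_eq ?_
        rw [norm_mul, htn]
      _ ≤ t * (M / (1 - t)) + M := by gcongr
      _ = M / (1 - t) := by field_simp; ring
  have hM : M ≤ M / (1 - t) :=
    le_div_self ((norm_nonneg _).trans h0) hpos (sub_le_self _ ht0)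
  induction n with
  | zero =>
    rw [cesaroSum_succ, cesaroSum_zero, add_sub_assoc]
    exact key _ _ (h0.trans hM) (h 0)
  | succ n ih =>
    have : cesaroSum t x (n + 1 + 1) - cesaroSum t x (n + 1)
        = t * (cesaroSum t x (n + 1) - cesaroSum t x n) + (x (n + 1 + 1) - x (n + 1)) := by
      rw [cesaroSum_succ (n + 1)]
      nth_rw 2 [cesaroSum_succ n]
      ring
    rw [this]
    exact key _ _ ih (h _)

theorem norm_cesaroSum_le (ht0 : 0 ≤ t) (ht1 : t < 1) {M : ℝ} (h0 : ‖x 0‖ ≤ M)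
    (h : ∀ k, ‖x (k + 1) - x k‖ ≤ M) (n : ℕ) :
    ‖cesaroSum t x n‖ ≤ (n + 1) * (M / (1 - t)) := by
  induction n with
  | zero =>
    rw [cesaroSum_zero, Nat.cast_zero, zero_add, one_mul]
    exact h0.trans
      (le_div_self ((norm_nonneg _).trans h0) (sub_pos.2 ht1) (sub_le_self _ ht0))
  | succ n ih =>
    have := norm_add_le (cesaroSum t x n) (cesaroSum t x (n + 1) - cesaroSum t x n)
    rw [add_sub_cancel] at this
    have h2 := norm_cesaroSum_sub_le ht0 ht1 h0 h n
    push_cast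
    linarith

/-- The factor `2` counts two contributions of at most `M / (1 - t)`: the increment of the numerator
and the change of the denominator. Only a uniform bound on the differences of `x` is needed. -/
theorem norm_genCesaro_sub_le (ht0 : 0 ≤ t) (ht1 : t < 1) {M : ℝ} (h0 : ‖x 0‖ ≤ M)
    (h : ∀ k, ‖x (k + 1) - x k‖ ≤ M) (n : ℕ) :
    ‖genCesaro t x (n + 1) - genCesaro t x n‖ ≤ 2 / (1 - t) / (n + 2) * M := by
  have hn1 : ((n : ℂ) + 1) ≠ 0 := by exact_mod_cast n.succ_ne_zero
  have hn2 : ((n : ℂ) + 2) ≠ 0 := by exact_mod_cast (n + 1).succ_ne_zero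
  have e : genCesaro t x (n + 1) - genCesaro t x n =
      ((cesaroSum t x (n + 1) - cesaroSum t x n) - cesaroSum t x n / (n + 1)) / (n + 2) := by
    have : ((n : ℂ) + 1 + 1) = n + 2 := by ring
    rw [genCesaro_eq, genCesaro_eq, Nat.cast_succ, this]
    field_simp
    ring
  have hc : ‖cesaroSum t x n / (n + 1)‖ ≤ M / (1 - t) := by
    have : ‖(n : ℂ) + 1‖ = n + 1 := by exact_mod_cast Complex.norm_natCast (n + 1)
    rw [norm_div, this, div_le_iff₀' (by positivity)]
    exact norm_cesaroSum_le ht0 ht1 h0 h n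
  have hn : ‖(n : ℂ) + 2‖ = n + 2 := by exact_mod_cast Complex.norm_natCast (n + 2)
  rw [e, norm_div, hn]
  calc _ ≤ (M / (1 - t) + M / (1 - t)) / (n + 2) := by
        gcongr
        exact (norm_sub_le _ _).trans (add_le_add (norm_cesaroSum_sub_le ht0 ht1 h0 h n) hc)
    _ = _ := by ring

/-- `x_n = (n choose m) t^(n-m)` is an eigenvector of `C_t` for the eigenvalue `1 / (m + 1)`. -/
theorem genCesaro_choose (t : ℝ) (m n : ℕ) :
    genCesaro t (fun n => (n.choose m : ℂ) * (t : ℂ) ^ (n - m)) n =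
      1 / ((m : ℂ) + 1) * ((n.choose m : ℂ) * (t : ℂ) ^ (n - m)) := by
  have hm : ((m : ℂ) + 1) ≠ 0 := by exact_mod_cast m.succ_ne_zero
  have hn : ∀ n : ℕ, ((n : ℂ) + 1) ≠ 0 := fun n => by exact_mod_cast n.succ_ne_zero
  rw [genCesaro_eq, div_eq_iff (hn n)]
  induction n with
  | zero =>
    rw [cesaroSum_zero]
    cases m <;> simp
  | succ n ih =>
    rw [cesaroSum_succ, ih]
    -- The subtraction `n - m` is truncated, so the entry where the binomial coefficient jumps from
    -- `0` to `1` is treated separately. Beyond it the recursion reduces to `(n choose m) (n + 1) =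
    -- (n + 1 choose m) (n + 1 - m)`.
    rcases lt_trichotomy (n + 1) m with h | h | h
    · simp [Nat.choose_eq_zero_of_lt h, Nat.choose_eq_zero_of_lt (Nat.lt_of_succ_lt h)]
    · subst h
      simp only [Nat.choose_succ_self, Nat.choose_self, Nat.sub_self]
      field_simp
      push_cast
      ring
    · obtain ⟨k, rfl⟩ := Nat.exists_eq_add_of_le (Nat.lt_succ_iff.1 h)
      have hk := congrArg (Nat.cast (R := ℂ)) (Nat.choose_mul_succ_eq (m + k) m)
      rw [show m + k + 1 - m = k + 1 by omega] at hk ⊢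
      rw [show m + k - m = k by omega]
      push_cast at hk ⊢
      field_simp
      rw [pow_succ]
      linear_combination (t : ℂ) * t ^ k * hk

end Sequences

/-! ### The operator on `bv_p`: compactness, spectrum and dynamics -/

namespace BV

variable {p : ℝ} [hp : Fact (1 < p)] {t : ℝ}

theorem norm_diff_genCesaro_le (ht0 : 0 ≤ t) (ht1 : t < 1) (x y : BV p)
    (hy : ∀ n, y n = genCesaro t x n) (k : ℕ) :
    ‖diff y k‖ ≤ 2 / (1 - t) / (k + 1) * ‖x‖ := by
  have hpos : 0 < 1 - t := sub_pos.2 ht1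
  cases k with
  | zero =>
    -- The zeroth difference is `x 0` itself, so the constant must be at least `1`.
    have h1 : 1 ≤ 2 / (1 - t) := by rw [one_le_div hpos]; linarith
    simp only [diff, hy, genCesaro_zero, Nat.cast_zero, zero_add, div_one]
    exact (norm_diff_le x 0).trans (le_mul_of_one_le_left (norm_nonneg _) h1)
  | succ k =>
    have := norm_genCesaro_sub_le (x := x) ht0 ht1 (norm_diff_le x 0)
      (fun k => norm_diff_le x (k + 1)) k
    simp only [diff, hy, Nat.cast_succ]
    rwa [add_assoc, one_add_one_eq_two]

theorem summable_div_succ_rpow (p : ℝ) [hp : Fact (1 < p)] {K : ℝ} (hK : 0 ≤ K) :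
    Summable fun k : ℕ => (K / (k + 1)) ^ p := by
  have h := ((summable_nat_add_iff 1).2 (Real.summable_one_div_nat_rpow.2 hp.out)).mul_left (K ^ p)
  refine h.congr fun k => ?_
  rw [Real.div_rpow hK (by positivity), Nat.cast_succ, mul_one_div]

theorem summable_diff_genCesaro (ht0 : 0 ≤ t) (ht1 : t < 1) (x : BV p) :
    Summable fun k => ‖genCesaro t x (k + 1) - genCesaro t x k‖ ^ p := by
  have hpos : 0 < 1 - t := sub_pos.2 ht1
  have hs := (summable_nat_add_iff 1).2 (summable_div_succ_rpow p (K := 2 / (1 - t)) (by positivity))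
  refine Summable.of_nonneg_of_le (fun k => by positivity) (fun k => ?_) (hs.mul_right (‖x‖ ^ p))
  rw [← Real.mul_rpow (by positivity) (norm_nonneg _)]
  refine Real.rpow_le_rpow (norm_nonneg _) ?_ (exponent_pos p).le
  have := norm_genCesaro_sub_le (x := x) ht0 ht1 (norm_diff_le x 0)
      (fun k => norm_diff_le x (k + 1)) k
  rwa [Nat.cast_succ, add_assoc, one_add_one_eq_two]

/-- The generalized Cesàro operator on `bv_p`. -/
def cesaro (p : ℝ) [hp : Fact (1 < p)] (ht0 : 0 ≤ t) (ht1 : t < 1) : BV p →L[ℂ] BV p :=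
  LinearMap.mkContinuous
    { toFun := fun x => mk (genCesaro t x) (summable_diff_genCesaro ht0 ht1 x)
      map_add' := fun x y => ext fun n => by
        simp only [mk_apply, map_add, genCesaro_add, Pi.add_apply]
      map_smul' := fun c x => ext fun n => by
        simp only [mk_apply, map_smul, genCesaro_smul, Pi.smul_apply, RingHom.id_apply] }
    -- This bound is the `ℓ^p` norm of the dominating sequence.
    ((∑' k : ℕ, (2 / (1 - t) / (k + 1)) ^ p) ^ (1 / p)) fun x => by
      have hp0 := exponent_pos p
      have hpos : 0 < 1 - t := sub_pos.2 ht1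
      have hs := summable_div_succ_rpow p (K := 2 / (1 - t)) (by positivity)
      have hle := norm_le_of_diff
        (x := mk (genCesaro t x) (summable_diff_genCesaro ht0 ht1 x)) (hs.mul_right (‖x‖ ^ p))
        fun k => by
          rw [← Real.mul_rpow (by positivity) (norm_nonneg _)]
          exact Real.rpow_le_rpow (norm_nonneg _)
            (norm_diff_genCesaro_le ht0 ht1 x _ (fun _ => rfl) k) hp0.le
      rwa [tsum_mul_right, Real.mul_rpow (tsum_nonneg fun k => by positivity) (by positivity),
        one_div, Real.rpow_rpow_inv (norm_nonneg _) hp0.ne', ← one_div] at hle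

variable (ht0 : 0 ≤ t) (ht1 : t < 1)

@[simp]
theorem cesaro_apply (x : BV p) (n : ℕ) : cesaro p ht0 ht1 x n = genCesaro t x n := rfl

theorem isCompactOperator_cesaro : IsCompactOperator (cesaro p ht0 ht1) := by
  have hpos : 0 < 1 - t := sub_pos.2 ht1
  exact isCompactOperator_of_diff_le (fun k => by positivity)
    (summable_div_succ_rpow p (K := 2 / (1 - t)) (by positivity))
    fun x k => norm_diff_genCesaro_le ht0 ht1 x _ (fun _ => rfl) k

theorem summable_norm_choose_mul_pow (ht0 : 0 ≤ t) (ht1 : t < 1) (m : ℕ) :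
    Summable fun n : ℕ => ‖(n.choose m : ℂ) * (t : ℂ) ^ (n - m)‖ := by
  have hr : ‖(t : ℂ)‖ < 1 := by rwa [Complex.norm_real, Real.norm_of_nonneg ht0]
  refine (summable_nat_add_iff m).1 ?_
  refine (summable_choose_mul_geometric_of_norm_lt_one m hr).norm.congr fun n => ?_
  rw [Nat.add_sub_cancel]

/-- The eigenvector `x_n = (n choose m) t^(n-m)` of `C_t`. -/
def eigenvector (p : ℝ) [hp : Fact (1 < p)] (ht0 : 0 ≤ t) (ht1 : t < 1) (m : ℕ) : BV p :=
  mk (fun n => (n.choose m : ℂ) * (t : ℂ) ^ (n - m)) <|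
    summable_diff_of_summable_norm (x := fun n => (n.choose m : ℂ) * (t : ℂ) ^ (n - m))
      (summable_norm_choose_mul_pow ht0 ht1 m)

theorem eigenvector_apply (m n : ℕ) :
    eigenvector p ht0 ht1 m n = (n.choose m : ℂ) * (t : ℂ) ^ (n - m) := rfl

theorem cesaro_eigenvector (m : ℕ) :
    cesaro p ht0 ht1 (eigenvector p ht0 ht1 m) =
      (1 / ((m : ℂ) + 1)) • eigenvector p ht0 ht1 m := by
  refine ext fun n => ?_
  rw [map_smul]
  exact genCesaro_choose t m n

theorem eigenvector_ne_zero (m : ℕ) : eigenvector p ht0 ht1 m ≠ 0 := fun h => by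
  have := eigenvector_apply (p := p) ht0 ht1 m m
  rw [h] at this
  simp at this

/-- The eigenvalue of an eigenvector of `C_t` is determined by its first nonzero coordinate. -/
theorem exists_eigenvalue_eq {x : BV p} (hx : x ≠ 0) {z : ℂ} (h : cesaro p ht0 ht1 x = z • x) :
    ∃ m : ℕ, z = 1 / ((m : ℂ) + 1) ∧ x m ≠ 0 := by
  have hex : ∃ n, x n ≠ 0 := by
    by_contra! h0
    exact hx (ext fun n => by simp [h0 n])
  classical
  refine ⟨Nat.find hex, ?_, Nat.find_spec hex⟩
  have h1 : cesaro p ht0 ht1 x (Nat.find hex) = z * x (Nat.find hex) := by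
    rw [h, map_smul]; rfl
  rw [cesaro_apply, genCesaro_of_forall_lt fun i hi => not_not.1 (Nat.find_min hex hi)] at h1
  refine mul_right_cancel₀ (Nat.find_spec hex) ?_
  rw [← h1]
  ring

theorem pointSpectrum_cesaro :
    pointSpectrum (cesaro p ht0 ht1) = {z : ℂ | ∃ n : ℕ, z = 1 / ((n : ℂ) + 1)} := by
  ext z
  constructor
  · intro hz
    obtain ⟨x, hx⟩ := Module.End.HasEigenvalue.exists_hasEigenvector hz
    obtain ⟨m, hm, -⟩ := exists_eigenvalue_eq ht0 ht1 hx.2 hx.apply_eq_smul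
    exact ⟨m, hm⟩
  · rintro ⟨m, rfl⟩
    exact Module.End.hasEigenvalue_of_hasEigenvector
      ⟨Module.End.mem_eigenspace_iff.2 (cesaro_eigenvector ht0 ht1 m), eigenvector_ne_zero ht0 ht1 m⟩

/-- Compactness makes every nonzero spectral value an eigenvalue; `0` belongs to the closed spectrum
as the limit of `1 / (n + 1)`. -/
theorem spectrum_cesaro :
    spectrum ℂ (cesaro p ht0 ht1) = {z : ℂ | ∃ n : ℕ, z = 1 / ((n : ℂ) + 1)} ∪ {0} := by
  have hne : ∀ z : ℂ, z ≠ 0 → (z ∈ spectrum ℂ (cesaro p ht0 ht1) ↔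
      ∃ n : ℕ, z = 1 / ((n : ℂ) + 1)) := fun z hz => by
    rw [← (isCompactOperator_cesaro ht0 ht1).hasEigenvalue_iff_mem_spectrum hz]
    exact Set.ext_iff.1 (pointSpectrum_cesaro ht0 ht1) z
  have hmem : ∀ n : ℕ, (1 / ((n : ℂ) + 1)) ∈ spectrum ℂ (cesaro p ht0 ht1) := fun n =>
    (hne _ (one_div_ne_zero (by exact_mod_cast n.succ_ne_zero))).2 ⟨n, rfl⟩
  have h0 : (0 : ℂ) ∈ spectrum ℂ (cesaro p ht0 ht1) :=
    (spectrum.isClosed _).mem_of_tendsto (tendsto_one_div_add_atTop_nhds_zero_nat (𝕜 := ℂ))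
      (Eventually.of_forall hmem)
  ext z
  by_cases hz : z = 0
  · subst hz
    exact ⟨fun _ => Or.inr rfl, fun _ => h0⟩
  · rw [hne z hz]
    simp [hz]

/-- The spectral projection of `C_t` for the eigenvalue `1`. -/
def fixedProj (p : ℝ) [hp : Fact (1 < p)] (ht0 : 0 ≤ t) (ht1 : t < 1) : BV p →L[ℂ] BV p :=
  (diffL p 0).smulRight (eigenvector p ht0 ht1 0)

theorem fixedProj_apply (x : BV p) :
    fixedProj p ht0 ht1 x = x 0 • eigenvector p ht0 ht1 0 := rfl

theorem eigenvector_zero_zero : eigenvector p ht0 ht1 0 0 = 1 := by simp [eigenvector_apply]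

theorem cesaro_apply_zero (x : BV p) : cesaro p ht0 ht1 x 0 = x 0 := by
  rw [cesaro_apply, genCesaro_zero]

theorem fixedProj_apply_zero (x : BV p) : fixedProj p ht0 ht1 x 0 = x 0 := by
  rw [fixedProj_apply, map_smul, Pi.smul_apply, eigenvector_zero_zero, smul_eq_mul, mul_one]

theorem fixedProj_mul_self :
    fixedProj p ht0 ht1 * fixedProj p ht0 ht1 = fixedProj p ht0 ht1 :=
  ContinuousLinearMap.ext fun x => by
    rw [ContinuousLinearMap.mul_def, ContinuousLinearMap.comp_apply,
      fixedProj_apply, fixedProj_apply_zero, fixedProj_apply]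

theorem cesaro_mul_fixedProj :
    cesaro p ht0 ht1 * fixedProj p ht0 ht1 = fixedProj p ht0 ht1 :=
  ContinuousLinearMap.ext fun x => by
    rw [ContinuousLinearMap.mul_def, ContinuousLinearMap.comp_apply,
      fixedProj_apply, map_smul, cesaro_eigenvector]
    simp

theorem fixedProj_mul_cesaro :
    fixedProj p ht0 ht1 * cesaro p ht0 ht1 = fixedProj p ht0 ht1 :=
  ContinuousLinearMap.ext fun x => by
    rw [ContinuousLinearMap.mul_def, ContinuousLinearMap.comp_apply,
      fixedProj_apply, cesaro_apply_zero, fixedProj_apply]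

theorem isCompactOperator_fixedProj : IsCompactOperator (fixedProj p ht0 ht1) :=
  (isCompactOperator_id (E := ℂ)).comp_clm (diffL p 0) |>.clm_comp
    ((1 : ℂ →L[ℂ] ℂ).smulRight (eigenvector p ht0 ht1 0))

/-- `C_t - P` is compact and its values have zeroth coordinate `0`. An eigenvector for `z ≠ 0` thus
has `x 0 = 0`, is killed by `P`, and is an eigenvector of `C_t` with eigenvalue `1 / (m + 1)` for
some `m ≥ 1`. -/
theorem spectralRadius_cesaro_sub_fixedProj_lt_one :
    spectralRadius ℂ (cesaro p ht0 ht1 - fixedProj p ht0 ht1) < 1 := by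
  have hle : spectralRadius ℂ (cesaro p ht0 ht1 - fixedProj p ht0 ht1) ≤
      ((2⁻¹ : NNReal) : ENNReal) := by
    refine iSup₂_le fun z hz => ENNReal.coe_le_coe.2 ?_
    rw [← NNReal.coe_le_coe, coe_nnnorm]
    rcases eq_or_ne z 0 with rfl | hz0
    · simp
    have hcomp : IsCompactOperator (cesaro p ht0 ht1 - fixedProj p ht0 ht1) :=
      (isCompactOperator_cesaro ht0 ht1).sub (isCompactOperator_fixedProj ht0 ht1)
    obtain ⟨x, hx⟩ := ((hcomp.hasEigenvalue_iff_mem_spectrum hz0).2 hz).exists_hasEigenvector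
    have hzx : cesaro p ht0 ht1 x - fixedProj p ht0 ht1 x = z • x := hx.apply_eq_smul
    have hx0 : x 0 = 0 := by
      have := congrArg (fun y : BV p => y 0) hzx
      simp only [map_sub, Pi.sub_apply, cesaro_apply_zero, fixedProj_apply_zero, sub_self, map_smul,
        Pi.smul_apply, smul_eq_mul] at this
      exact (mul_eq_zero.1 this.symm).resolve_left hz0
    rw [fixedProj_apply, hx0, zero_smul, sub_zero] at hzx
    obtain ⟨m, rfl, hm⟩ := exists_eigenvalue_eq ht0 ht1 hx.2 hzx
    have hm1 : 1 ≤ m := Nat.one_le_iff_ne_zero.2 fun h => hm (h ▸ hx0)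
    have hm2 : (2 : ℝ) ≤ m + 1 := by
      have : (1 : ℝ) ≤ m := by exact_mod_cast hm1
      linarith
    have hn : ‖(m : ℂ) + 1‖ = m + 1 := by exact_mod_cast Complex.norm_natCast (m + 1)
    rw [norm_div, norm_one, hn, one_div]
    exact inv_anti₀ two_pos hm2
  refine hle.trans_lt ?_
  rw [← ENNReal.coe_one, ENNReal.coe_lt_coe]
  exact inv_lt_one_of_one_lt₀ one_lt_two

theorem tendsto_cesaro_pow :
    Tendsto (fun n : ℕ => cesaro p ht0 ht1 ^ n) atTop (𝓝 (fixedProj p ht0 ht1)) := by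
  have h := spectrum.tendsto_pow_zero_of_spectralRadius_lt_one
    (spectralRadius_cesaro_sub_fixedProj_lt_one (p := p) ht0 ht1)
  rw [← tendsto_add_atTop_iff_nat 1] at h ⊢
  have h2 := h.add_const (fixedProj p ht0 ht1)
  rw [zero_add] at h2
  refine h2.congr fun n => ?_
  rw [sub_pow_succ_of_absorbing (fixedProj_mul_self ht0 ht1) (cesaro_mul_fixedProj ht0 ht1)
    (fixedProj_mul_cesaro ht0 ht1), sub_add_cancel]

theorem not_isSupercyclic_cesaro : ¬ IsSupercyclic (cesaro p ht0 ht1) := by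
  -- The functional `x_1 - t x_0` written in difference coordinates, as `(x_1 - x_0) + (1 - t) x_0`,
  -- which makes its continuity evident.
  have hg : ∀ x : BV p, (diffL p 1 + (1 - t : ℂ) • diffL p 0) x = x 1 - t * x 0 := fun x => by
    change (x 1 - x 0) + (1 - t : ℂ) * x 0 = _
    ring
  refine not_isSupercyclic_of_dual_eigenvectors (f := diffL p 0)
    (g := diffL p 1 + (1 - t : ℂ) • diffL p 0) (c := 1 / 2) (by norm_num)
    (cesaro_apply_zero ht0 ht1) (fun x => ?_) (u := eigenvector p ht0 ht1 0)
    (v := eigenvector p ht0 ht1 1) ?_ ?_ ?_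
  · rw [hg, hg, cesaro_apply_zero, cesaro_apply, genCesaro_eq, cesaroSum_succ, cesaroSum_zero]
    push_cast
    ring
  · change eigenvector p ht0 ht1 0 0 ≠ 0
    simp [eigenvector_apply]
  · change eigenvector p ht0 ht1 1 0 = 0
    simp [eigenvector_apply]
  · rw [hg]
    simp [eigenvector_apply]

end BV
end

theorem propositionP11p2 (p : ℝ) [Fact (1 < p)] (t : ℝ) (ht0 : 0 ≤ t) (ht1 : t < 1) :
    ∃ T : BV p →L[ℂ] BV p,
      (∀ (x : BV p) (n : ℕ), T x n = genCesaro t x n) ∧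
      IsCompactOperator T ∧
      pointSpectrum T = {z : ℂ | ∃ n : ℕ, z = 1 / ((n : ℂ) + 1)} ∧
      spectrum ℂ T = {z : ℂ | ∃ n : ℕ, z = 1 / ((n : ℂ) + 1)} ∪ {0} ∧
      IsPowerBounded T ∧
      IsUniformlyMeanErgodic T ∧
      ¬ IsSupercyclic T :=
  ⟨BV.cesaro p ht0 ht1, BV.cesaro_apply ht0 ht1, BV.isCompactOperator_cesaro ht0 ht1,
    BV.pointSpectrum_cesaro ht0 ht1, BV.spectrum_cesaro ht0 ht1,
    .of_tendsto (BV.tendsto_cesaro_pow ht0 ht1), .of_tendsto (BV.tendsto_cesaro_pow ht0 ht1),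
    BV.not_isSupercyclic_cesaro ht0 ht1⟩
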